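/- Let $c' \ge 0$. There is a constant $\alpha > 0$, depending only on $c'$, such that the following holds. Let $k \in \mathbb{N}$, let $X_1,\dots,X_k$ be independent random variables taking values in $\{0,1\}$, with $\Pr[X_i = 1] = p_i$, and let $S := \sum_{i=1}^k X_i$ and $\mu := \sum_{i=1}^k p_i$. Let $\sigma$ be a real number with $\sigma \ge 20e^{c'^2}$ and $\sum_{i=1}^k p_i(1-p_i) \ge \sigma^2$. Then $$\Pr[S > \mu + c'\sigma] \ge \alpha \qquad\text{and}\qquad \Pr[S < \mu - c'\sigma] \ge \alpha .$$ -/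

import Mathlib

open MeasureTheory ProbabilityTheory

/-!
The bound is Cramér's change of measure combined with Chebyshev's inequality; no central limit
theorem is needed. Let `s` be the standard deviation of the sum `S`, so that `σ ≤ s` and it is
enough to treat deviations of size `c * s`. Tilt the probability measure by `exp (u * S)` with
`u = (2 * c + 4) / s`; the growth condition on `σ` gives `u ≤ 1 / 4`. The cumulant generating
function of `S` is the sum of Bernoulli ones, and its first two derivatives are the mean and the
variance of `S` under the tilted measure. For `u ≤ 1 / 4`, tilting moves the mean up by between
`4 / 5 * u * s ^ 2` and `4 / 3 * u * s ^ 2` (`le_tiltedMean_sub`, `tiltedMean_sub_le`) and keeps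
the variance at most `4 / 3 * s ^ 2` (`tiltedMean_mul_one_sub_le`).

Hence the window of radius `2 * s` around the tilted mean has tilted mass at least `2 / 3`, and it
lies above `μ + c * s`. On that window the tilted density is bounded in terms of `c` alone, as the
cumulant generating function at `u` is at least `u * μ`. So the window also has original
probability bounded below in terms of `c` (`le_exp_mul_measureReal_abs_sub_lt`,
`le_measureReal_sum_gt`). The lower tail is the upper tail for the variables `1 - X i`.
-/

/-- A random variable that is almost surely `0` or `1` has the Bernoulli moment generating
function. -/
lemma mgf_of_ae_zero_or_one {Ω : Type*} [MeasurableSpace Ω] {P : Measure Ω}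
    [IsProbabilityMeasure P] {X : Ω → ℝ} (hX : Measurable X)
    (h01 : ∀ᵐ ω ∂P, X ω = 0 ∨ X ω = 1) (u : ℝ) :
    mgf X P u = 1 - P.real {ω | X ω = 1} + P.real {ω | X ω = 1} * Real.exp u := by
  have hs : MeasurableSet {ω | X ω = 1} := hX (measurableSet_singleton 1)
  have hae : (fun ω => Real.exp (u * X ω)) =ᵐ[P]
      fun ω => 1 + Set.indicator {ω | X ω = 1} (fun _ => Real.exp u - 1) ω := by
    filter_upwards [h01] with ω hω
    rcases hω with h | h <;> simp [Set.indicator, h]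
  rw [mgf, integral_congr_ae hae, integral_add (integrable_const _)
    ((integrable_const _).indicator hs), integral_indicator_const _ hs]
  simp only [integral_const, probReal_univ, smul_eq_mul]
  ring

lemma integrable_exp_mul_of_ae_zero_or_one {Ω : Type*} [MeasurableSpace Ω] {P : Measure Ω}
    [IsProbabilityMeasure P] {X : Ω → ℝ} (hX : Measurable X)
    (h01 : ∀ᵐ ω ∂P, X ω = 0 ∨ X ω = 1) (u : ℝ) :
    Integrable (fun ω => Real.exp (u * X ω)) P := by
  refine Integrable.of_bound (by fun_prop) (1 + Real.exp u) ?_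
  filter_upwards [h01] with ω hω
  have := Real.exp_pos u
  rcases hω with h | h
  · simp [h, this.le]
  · simp [h]

/-- The mean of a Bernoulli variable of parameter `p` after exponential tilting by `u`;
equivalently, the derivative at `u` of its cumulant generating function. -/
noncomputable def tiltedMean (p u : ℝ) : ℝ :=
  p * Real.exp u / (1 - p + p * Real.exp u)

section TiltedMean

variable {p u : ℝ}

lemma one_sub_add_mul_exp_pos (h0 : 0 ≤ p) (h1 : p ≤ 1) : 0 < 1 - p + p * Real.exp u := by
  rcases h0.eq_or_lt with rfl | hp
  · simp
  · have := mul_pos hp (Real.exp_pos u)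
    linarith

lemma hasDerivAt_log_one_sub_add_mul_exp (h0 : 0 ≤ p) (h1 : p ≤ 1) :
    HasDerivAt (fun u => Real.log (1 - p + p * Real.exp u)) (tiltedMean p u) u :=
  (((Real.hasDerivAt_exp u).const_mul p).const_add (1 - p)).log
    (one_sub_add_mul_exp_pos h0 h1).ne'

lemma hasDerivAt_tiltedMean (h0 : 0 ≤ p) (h1 : p ≤ 1) :
    HasDerivAt (tiltedMean p) (tiltedMean p u * (1 - tiltedMean p u)) u := by
  have hD := (one_sub_add_mul_exp_pos (u := u) h0 h1).ne'
  have hd := (Real.hasDerivAt_exp u).const_mul p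
  refine (hd.div (hd.const_add (1 - p)) hD).congr_deriv ?_
  unfold tiltedMean
  field_simp

/-- Jensen's inequality for the Bernoulli cumulant generating function. -/
lemma mul_le_log_one_sub_add_mul_exp (h0 : 0 ≤ p) (h1 : p ≤ 1) :
    p * u ≤ Real.log (1 - p + p * Real.exp u) := by
  rw [Real.le_log_iff_exp_le (one_sub_add_mul_exp_pos h0 h1)]
  have := convexOn_exp.2 (Set.mem_univ 0) (Set.mem_univ u) (sub_nonneg.2 h1) h0 (by ring)
  simpa using this

lemma exp_le_one_add_mul (hu : 0 ≤ u) (hu' : u ≤ 1 / 4) : Real.exp u ≤ 1 + 4 / 3 * u := by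
  have h1 := Real.one_sub_le_exp_neg u
  have h2 : Real.exp u * Real.exp (-u) = 1 := by rw [← Real.exp_add]; simp
  have h3 : Real.exp u * (1 - u) ≤ 1 :=
    (mul_le_mul_of_nonneg_left h1 (Real.exp_pos u).le).trans_eq h2
  nlinarith

lemma tiltedMean_sub (h0 : 0 ≤ p) (h1 : p ≤ 1) :
    tiltedMean p u - p = p * (1 - p) * ((Real.exp u - 1) / (1 - p + p * Real.exp u)) := by
  have hD := (one_sub_add_mul_exp_pos (u := u) h0 h1).ne'
  unfold tiltedMean
  field_simp
  ring

lemma le_tiltedMean_sub (h0 : 0 ≤ p) (h1 : p ≤ 1) (hu : 0 ≤ u) (hu' : u ≤ 1 / 4) :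
    4 / 5 * u * (p * (1 - p)) ≤ tiltedMean p u - p := by
  have hD := one_sub_add_mul_exp_pos (u := u) h0 h1
  have hE := Real.add_one_le_exp u
  have hv : 0 ≤ p * (1 - p) := mul_nonneg h0 (sub_nonneg.2 h1)
  rw [tiltedMean_sub h0 h1, mul_comm]
  refine mul_le_mul_of_nonneg_left ?_ hv
  rw [le_div_iff₀ hD]
  have hDE : 1 - p + p * Real.exp u ≤ Real.exp u := by nlinarith
  calc 4 / 5 * u * (1 - p + p * Real.exp u) ≤ 4 / 5 * u * Real.exp u := by gcongr
    _ ≤ Real.exp u - 1 := by nlinarith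

lemma tiltedMean_sub_le (h0 : 0 ≤ p) (h1 : p ≤ 1) (hu : 0 ≤ u) (hu' : u ≤ 1 / 4) :
    tiltedMean p u - p ≤ 4 / 3 * u * (p * (1 - p)) := by
  have hE := Real.one_le_exp hu
  have hv : 0 ≤ p * (1 - p) := mul_nonneg h0 (sub_nonneg.2 h1)
  rw [tiltedMean_sub h0 h1, mul_comm (4 / 3 * u)]
  refine mul_le_mul_of_nonneg_left ?_ hv
  exact (div_le_self (by linarith) (by nlinarith)).trans
    (by linarith [exp_le_one_add_mul hu hu'])

lemma tiltedMean_mul_one_sub_le (h0 : 0 ≤ p) (h1 : p ≤ 1) (hu : 0 ≤ u) (hu' : u ≤ 1 / 4) :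
    tiltedMean p u * (1 - tiltedMean p u) ≤ 4 / 3 * (p * (1 - p)) := by
  have hD := one_sub_add_mul_exp_pos (u := u) h0 h1
  have hE := Real.one_le_exp hu
  have hv : 0 ≤ p * (1 - p) := mul_nonneg h0 (sub_nonneg.2 h1)
  have hD1 : 1 ≤ (1 - p + p * Real.exp u) ^ 2 := one_le_pow₀ (by nlinarith)
  have : tiltedMean p u * (1 - tiltedMean p u)
      = p * (1 - p) * Real.exp u / (1 - p + p * Real.exp u) ^ 2 := by
    unfold tiltedMean
    field_simp
    ring
  rw [this, mul_comm (4 / 3 : ℝ)]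
  refine (div_le_self (by positivity) hD1).trans (mul_le_mul_of_nonneg_left ?_ hv)
  linarith [exp_le_one_add_mul hu hu']

end TiltedMean

/-- **Cramér's change of measure.** If tilting by `u` brings the mean of `S` to `m`, then the
window of radius `r` around `m` has tilted mass at least `1 - v / r ^ 2` by Chebyshev's inequality,
and on this window the tilted density is at most `exp (u * (m + r) - cgf S P u)`. -/
lemma le_exp_mul_measureReal_abs_sub_lt {Ω : Type*} [MeasurableSpace Ω] {P : Measure Ω}
    [IsProbabilityMeasure P] {S : Ω → ℝ} (hS : Measurable S)
    (hint : ∀ u, Integrable (fun ω => Real.exp (u * S ω)) P)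
    {u m v r : ℝ} (hu : 0 ≤ u) (hr : 0 < r)
    (hm : deriv (cgf S P) u = m) (hv : iteratedDeriv 2 (cgf S P) u ≤ v) :
    1 - v / r ^ 2 ≤
      Real.exp (u * (m + r) - cgf S P u) * P.real {ω | |S ω - m| < r} := by
  have hmem : u ∈ interior (integrableExpSet S P) := by
    have : integrableExpSet S P = Set.univ := Set.eq_univ_of_forall hint
    simp [this]
  have : IsProbabilityMeasure (P.tilted (u * S ·)) := isProbabilityMeasure_tilted (hint u)
  have hA : MeasurableSet {ω | |S ω - m| < r} :=
    measurableSet_lt (by fun_prop) measurable_const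
  have hch := meas_ge_le_variance_div_sq (memLp_tilted_mul hmem 2) hr
  rw [integral_tilted_mul_self hmem, hm, variance_tilted_mul hmem] at hch
  have hcompl : {ω | r ≤ |S ω - m|} = {ω | |S ω - m| < r}ᶜ := by ext ω; simp
  have hvar : 0 ≤ iteratedDeriv 2 (cgf S P) u := by
    rw [← variance_tilted_mul hmem]; exact variance_nonneg _ _
  have hreal : (P.tilted (u * S ·)).real {ω | |S ω - m| < r}ᶜ ≤ v / r ^ 2 := by
    rw [← hcompl, measureReal_def]
    refine (ENNReal.toReal_le_of_le_ofReal (by positivity) hch).trans (by gcongr)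
  rw [probReal_compl_eq_one_sub hA] at hreal
  have htilt : (P.tilted (u * S ·)).real {ω | |S ω - m| < r} ≤
      Real.exp (u * (m + r) - cgf S P u) * P.real {ω | |S ω - m| < r} := by
    rw [measureReal_def, tilted_mul_apply_cgf _ (hint u)]
    refine ENNReal.toReal_le_of_le_ofReal (by positivity) ?_
    calc _ ≤ ∫⁻ _ in {ω | |S ω - m| < r},
            ENNReal.ofReal (Real.exp (u * (m + r) - cgf S P u)) ∂P := by
          refine setLIntegral_mono measurable_const fun ω hω => ?_
          have : S ω ≤ m + r := by
            linarith [(abs_lt.1 (show |S ω - m| < r from hω)).2]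
          gcongr
      _ = _ := by
          rw [setLIntegral_const, ENNReal.ofReal_mul (Real.exp_pos _).le, ofReal_measureReal]
  linarith

section Sum

variable {Ω : Type*} [MeasurableSpace Ω] {P : Measure Ω} [IsProbabilityMeasure P] {ι : Type*}
  [Fintype ι] {X : ι → Ω → ℝ} {p : ι → ℝ}

lemma cgf_sum_of_ae_zero_or_one (hX : ∀ i, Measurable (X i)) (hind : iIndepFun X P)
    (h01 : ∀ i, ∀ᵐ ω ∂P, X i ω = 0 ∨ X i ω = 1) (hp : ∀ i, P.real {ω | X i ω = 1} = p i) :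
    cgf (∑ i, X i) P = fun u => ∑ i, Real.log (1 - p i + p i * Real.exp u) := by
  funext u
  rw [hind.cgf_sum hX fun i _ => integrable_exp_mul_of_ae_zero_or_one (hX i) (h01 i) u]
  simp_rw [cgf, mgf_of_ae_zero_or_one (hX _) (h01 _), hp]

/-- Upper tail bound at scale `s`, the exact standard deviation of the sum. -/
lemma le_measureReal_sum_gt (hX : ∀ i, Measurable (X i)) (hind : iIndepFun X P)
    (h01 : ∀ i, ∀ᵐ ω ∂P, X i ω = 0 ∨ X i ω = 1) (hp : ∀ i, P.real {ω | X i ω = 1} = p i)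
    {c s : ℝ} (hc : 0 ≤ c) (hs : 20 * Real.exp (c ^ 2) ≤ s)
    (hvar : ∑ i, p i * (1 - p i) = s ^ 2) :
    2 / 3 * Real.exp (-((2 * c + 4) * (4 / 3 * (2 * c + 4) + 2))) ≤
      P.real {ω | (∑ i, p i) + c * s < ∑ i, X i ω} := by
  have h0 : ∀ i, 0 ≤ p i := fun i => hp i ▸ measureReal_nonneg
  have h1 : ∀ i, p i ≤ 1 := fun i => hp i ▸ measureReal_le_one
  have hE := Real.add_one_le_exp (c ^ 2)
  have hs0 : 0 < s := by nlinarith [sq_nonneg c]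
  set t : ℝ := 2 * c + 4 with ht
  set u : ℝ := t / s with hu_def
  have hus : u * s = t := div_mul_cancel₀ _ hs0.ne'
  have hu : 0 ≤ u := by positivity
  -- by `1 + c ^ 2 ≤ exp (c ^ 2)` and `2 * c ≤ 1 + c ^ 2`
  have hu' : u ≤ 1 / 4 := by
    rw [hu_def, div_le_iff₀ hs0]
    nlinarith [sq_nonneg (c - 1)]
  set S : Ω → ℝ := ∑ i, X i with hS_def
  have hSm : Measurable S := by fun_prop
  have hint : ∀ u, Integrable (fun ω => Real.exp (u * S ω)) P := fun u =>
    hind.integrable_exp_mul_sum hX fun i _ =>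
      integrable_exp_mul_of_ae_zero_or_one (hX i) (h01 i) u
  have hK := cgf_sum_of_ae_zero_or_one hX hind h01 hp
  have hK1 : deriv (cgf S P) = fun u => ∑ i, tiltedMean (p i) u := by
    funext u
    rw [hK]
    exact (HasDerivAt.fun_sum fun i _ =>
      hasDerivAt_log_one_sub_add_mul_exp (h0 i) (h1 i)).deriv
  have hK2 : iteratedDeriv 2 (cgf S P) u ≤ 4 / 3 * s ^ 2 := by
    rw [iteratedDeriv_succ, iteratedDeriv_one, hK1,
      (HasDerivAt.fun_sum fun i _ => hasDerivAt_tiltedMean (h0 i) (h1 i)).deriv, ← hvar,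
      Finset.mul_sum]
    exact Finset.sum_le_sum fun i _ => tiltedMean_mul_one_sub_le (h0 i) (h1 i) hu hu'
  have hcgf : u * ∑ i, p i ≤ cgf S P u := by
    rw [hK, Finset.mul_sum]
    refine Finset.sum_le_sum fun i _ => ?_
    rw [mul_comm]
    exact mul_le_log_one_sub_add_mul_exp (h0 i) (h1 i)
  set m : ℝ := ∑ i, tiltedMean (p i) u with hm_def
  have hm_lower : 4 / 5 * t * s ≤ m - ∑ i, p i := by
    have : 4 / 5 * t * s = 4 / 5 * u * s ^ 2 := by rw [← hus]; ring
    rw [this, ← hvar, hm_def, ← Finset.sum_sub_distrib, Finset.mul_sum]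
    exact Finset.sum_le_sum fun i _ => le_tiltedMean_sub (h0 i) (h1 i) hu hu'
  have hm_upper : m - ∑ i, p i ≤ 4 / 3 * t * s := by
    have : 4 / 3 * t * s = 4 / 3 * u * s ^ 2 := by rw [← hus]; ring
    rw [this, ← hvar, hm_def, ← Finset.sum_sub_distrib, Finset.mul_sum]
    exact Finset.sum_le_sum fun i _ => tiltedMean_sub_le (h0 i) (h1 i) hu hu'
  have key := le_exp_mul_measureReal_abs_sub_lt hSm hint hu (r := 2 * s) (by positivity)
    (congrFun hK1 u) hK2
  have hfrac : (1 : ℝ) - 4 / 3 * s ^ 2 / (2 * s) ^ 2 = 2 / 3 := by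
    field_simp
    norm_num
  rw [hfrac] at key
  have hexp : u * (m + 2 * s) - cgf S P u ≤ t * (4 / 3 * t + 2) := by
    have h3 : u * (m - ∑ i, p i) ≤ u * (4 / 3 * t * s) := by gcongr
    have h4 : u * (4 / 3 * t * s) = 4 / 3 * t * t := by rw [← hus]; ring
    have h5 : u * (m + 2 * s) = u * (m - ∑ i, p i) + u * ∑ i, p i + 2 * t := by
      rw [← hus]; ring
    linarith
  -- the Chebyshev window lies in the tail event because `4 / 5 * (2 * c + 4) - 2 > c`
  have hsub : {ω | |S ω - m| < 2 * s} ⊆ {ω | (∑ i, p i) + c * s < ∑ i, X i ω} := by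
    intro ω hω
    have h6 := (abs_lt.1 (show |S ω - m| < 2 * s from hω)).1
    have h7 : S ω = ∑ i, X i ω := by simp [hS_def]
    rw [h7] at h6
    have h8 : 4 / 5 * t * s = c * s + 2 * s + (3 / 5 * c + 6 / 5) * s := by rw [ht]; ring
    have h9 : 0 < (3 / 5 * c + 6 / 5) * s := by positivity
    show (∑ i, p i) + c * s < ∑ i, X i ω
    linarith
  rw [Real.exp_neg, ← div_eq_mul_inv, div_le_iff₀ (Real.exp_pos _), mul_comm]
  calc (2 / 3 : ℝ) ≤ _ := key
    _ ≤ _ := mul_le_mul (Real.exp_le_exp.2 hexp) (measureReal_mono hsub)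
      measureReal_nonneg (Real.exp_pos _).le

end Sum

theorem mainTheorem10 (c : ℝ) (hc : 0 ≤ c) :
    ∃ α : ℝ, 0 < α ∧
      ∀ (k : ℕ) (p : Fin k → ℝ) (σ : ℝ)
        (Ω : Type*) [MeasurableSpace Ω] (P : Measure Ω) [IsProbabilityMeasure P]
        (X : Fin k → Ω → ℝ),
        (∀ i, Measurable (X i)) →
        iIndepFun X P →
        (∀ i, ∀ᵐ ω ∂P, X i ω = 0 ∨ X i ω = 1) →
        (∀ i, P.real {ω | X i ω = 1} = p i) →
        20 * Real.exp (c ^ 2) ≤ σ →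
        σ ^ 2 ≤ ∑ i, p i * (1 - p i) →
        α ≤ P.real {ω | (∑ i, X i ω) > (∑ i, p i) + c * σ} ∧
        α ≤ P.real {ω | (∑ i, X i ω) < (∑ i, p i) - c * σ} := by
  refine ⟨2 / 3 * Real.exp (-((2 * c + 4) * (4 / 3 * (2 * c + 4) + 2))), by positivity, ?_⟩
  intro k p σ Ω _ P _ X hX hind h01 hp hσ hvar
  set V : ℝ := ∑ i, p i * (1 - p i) with hV
  have hσV : σ ≤ √V := Real.le_sqrt_of_sq_le hvar
  have hcσ : c * σ ≤ c * √V := by gcongr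
  have hVs : V = √V ^ 2 := (Real.sq_sqrt ((sq_nonneg σ).trans hvar)).symm
  constructor
  · refine (le_measureReal_sum_gt hX hind h01 hp hc (hσ.trans hσV) (hV ▸ hVs)).trans
      (measureReal_mono fun ω hω => ?_)
    have hω' : (∑ i, p i) + c * √V < ∑ i, X i ω := hω
    show (∑ i, p i) + c * σ < ∑ i, X i ω
    linarith
  -- the lower tail is the upper tail of the sum of the complementary variables `1 - X i`
  · have hY01 : ∀ i, ∀ᵐ ω ∂P, 1 - X i ω = 0 ∨ 1 - X i ω = 1 := fun i => by
      filter_upwards [h01 i] with ω hω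
      rcases hω with h | h <;> simp [h]
    have hYp : ∀ i, P.real {ω | 1 - X i ω = 1} = 1 - p i := fun i => by
      have hs : MeasurableSet {ω | X i ω = 1} := hX i (measurableSet_singleton 1)
      rw [← hp i, ← probReal_compl_eq_one_sub hs]
      refine measureReal_congr ?_
      filter_upwards [h01 i] with ω hω
      have : (1 - X i ω = 1) = ¬ (X i ω = 1) := by rcases hω with h | h <;> simp [h]
      exact this
    have hYind : iIndepFun (fun i ω => 1 - X i ω) P :=
      hind.comp (fun _ x => 1 - x) fun _ => by fun_prop
    have hYvar : ∑ i, (1 - p i) * (1 - (1 - p i)) = √V ^ 2 := by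
      rw [← hVs, hV]
      exact Finset.sum_congr rfl fun i _ => by ring
    refine (le_measureReal_sum_gt (fun i => (hX i).const_sub 1) hYind hY01 hYp hc
      (hσ.trans hσV) hYvar).trans (measureReal_mono fun ω hω => ?_)
    have hω' : (∑ i, (1 - p i)) + c * √V < ∑ i, (1 - X i ω) := hω
    show ∑ i, X i ω < (∑ i, p i) - c * σ
    simp only [Finset.sum_sub_distrib] at hω'
    linarith
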